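/- \textbf{Setting.} Let $\mathbf{C}$ be an adhesive category: $\mathbf{C}$ has pullbacks and has pushouts along monomorphisms, and pushouts along monomorphisms are van Kampen squares. Given $A\xrightarrow{a}B\xrightarrow{c}X$, a pair $A\xrightarrow{b}D\xrightarrow{d}X$ is a \emph{final pullback complement (FPC)} of it if $(a,b)$ is a pullback of $(c,d)$ and, for all $z:T\to X$, every pullback $(x:P\to B,\;y:P\to T)$ of $(c,z)$ and every $w:P\to A$ with $a\circ w=x$, there is a unique $w^*:T\to D$ with $d\circ w^*=z$ and $w^*\circ y=b\circ w$. Assume that every composable pair of monomorphisms of $\mathbf{C}$ has an FPC, and that FPCs of pairs of monomorphisms are pairs of monomorphisms. A \emph{linear production} is a span of monomorphisms $p=(O\xleftarrow{o}K\xrightarrow{i}I)$; two linear productions are isomorphic ($\cong$) if there are isomorphisms $O\cong O'$, $K\cong K'$, $I\cong I'$ commuting with the legs. For linear productions $p_j=(O_j\xleftarrow{o_j}K_j\xrightarrow{i_j}I_j)$, $j=1,2$, an \emph{SqPO-admissible match} of $p_2$ into $p_1$ is a span of monomorphisms $\mathbf{m}=(I_2\xleftarrow{m_2}M\xrightarrow{m_1}O_1)$,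 taken up to isomorphism of $M$ over $I_2$ and $O_1$, such that for the pushout $I_2\xrightarrow{n_2}N\xleftarrow{n_1}O_1$ of $\mathbf{m}$ the pair $K_1\xrightarrow{o_1}O_1\xrightarrow{n_1}N$ has a pushout complement $K_1\xrightarrow{k_1}\overline K_1\xrightarrow{o_1'}N$. In this case let $I_{21}$, with $i_1':\overline K_1\to I_{21}$, be the pushout of $I_1\xleftarrow{i_1}K_1\xrightarrow{k_1}\overline K_1$; let $K_2\xrightarrow{k_2}\overline K_2\xrightarrow{i_2'}N$ be the FPC of $K_2\xrightarrow{i_2}I_2\xrightarrow{n_2}N$; let $O_{21}$, with $o_2':\overline K_2\to O_{21}$, be the pushout of $O_2\xleftarrow{o_2}K_2\xrightarrow{k_2}\overline K_2$; and let $\overline K_2\xleftarrow{i_2''}K_{21}\xrightarrow{o_1''}\overline K_1$ be the pullback of $\overline K_2\xrightarrow{i_2'}N\xleftarrow{o_1'}\overline K_1$. The \emph{composite} of $p_2$ with $p_1$ along $\mathbf{m}$ is the linear production $$p_2\stackrel{\mathbf m}{\triangleleft}p_1:=(O_{21}\xleftarrow{\,o_2'\circ i_2''\,}K_{21}\xrightarrow{\,i_1'\circ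 o_1''\,}I_{21}),$$ which is determined up to isomorphism; fix a representative of each composite. \textbf{Theorem (SqPO-type associativity theorem).} Let $p_1,p_2,p_3$ be linear productions of $\mathbf{C}$. There is a bijection from the set of pairs $(\mathbf m_{21},\mathbf m_{3(21)})$, where $\mathbf m_{21}$ is an SqPO-admissible match of $p_2$ into $p_1$ and $\mathbf m_{3(21)}$ is an SqPO-admissible match of $p_3$ into $p_2\stackrel{\mathbf m_{21}}{\triangleleft}p_1$, onto the set of pairs $(\mathbf m_{32},\mathbf m_{(32)1})$, where $\mathbf m_{32}$ is an SqPO-admissible match of $p_3$ into $p_2$ and $\mathbf m_{(32)1}$ is an SqPO-admissible match of $p_3\stackrel{\mathbf m_{32}}{\triangleleft}p_2$ into $p_1$, such that for corresponding pairs $$p_3\stackrel{\mathbf m_{3(21)}}{\triangleleft}\bigl(p_2\stackrel{\mathbf m_{21}}{\triangleleft}p_1\bigr)\;\cong\;\bigl(p_3\stackrel{\mathbf m_{32}}{\triangleleft}p_2\bigr)\stackrel{\mathbf m_{(32)1}}{\triangleleft}p_1 .$$ -/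

import Mathlib

open CategoryTheory CategoryTheory.Limits

universe v u

namespace SqPO

/-- Given `A --a--> B --c--> X`, the pair `A --b--> D --d--> X` is a final pullback complement
(FPC) of it: the square `A, B, X, D` is a pullback, and for every `z : T ⟶ X`, every pullback
`(x, y)` of `(c, z)` and every `w` with `w ≫ a = x`, there is a unique `w' : T ⟶ D` with
`w' ≫ d = z` and `y ≫ w' = w ≫ b`. -/
structure IsFPC {C : Type u} [Category.{v} C] {A B D X : C}
    (a : A ⟶ B) (c : B ⟶ X) (b : A ⟶ D) (d : D ⟶ X) : Prop where
  isPullback : IsPullback a b c d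
  existsUnique_lift : ∀ {P T : C} (x : P ⟶ B) (y : P ⟶ T) (z : T ⟶ X) (w : P ⟶ A),
    IsPullback x y c z → w ≫ a = x → ∃! w' : T ⟶ D, w' ≫ d = z ∧ y ≫ w' = w ≫ b

/-- All FPCs of composable pairs of monomorphisms exist, and monomorphisms are stable under
FPCs, i.e. FPCs of pairs of monomorphisms are pairs of monomorphisms. -/
class HasMonoFPCs (C : Type u) [Category.{v} C] : Prop where
  exists_isFPC : ∀ {A B X : C} (a : A ⟶ B) (c : B ⟶ X) [Mono a] [Mono c],
    ∃ (D : C) (b : A ⟶ D) (d : D ⟶ X), IsFPC a c b d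
  mono_of_isFPC : ∀ {A B D X : C} {a : A ⟶ B} {c : B ⟶ X} {b : A ⟶ D} {d : D ⟶ X}
    [Mono a] [Mono c], IsFPC a c b d → Mono b ∧ Mono d

/-- A linear production `O ⟵ K ⟶ I`: a span of monomorphisms. -/
structure LinearProduction (C : Type u) [Category.{v} C] where
  O : C
  K : C
  I : C
  o : K ⟶ O
  i : K ⟶ I
  [mono_o : Mono o]
  [mono_i : Mono i]

attribute [instance] LinearProduction.mono_o LinearProduction.mono_i

/-- Two linear productions are isomorphic if there are isomorphisms of their output, context and
input objects that commute with the legs of the two spans. -/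
def LinearProduction.IsIsomorphic {C : Type u} [Category.{v} C]
    (p q : LinearProduction C) : Prop :=
  ∃ (eO : p.O ≅ q.O) (eK : p.K ≅ q.K) (eI : p.I ≅ q.I),
    p.o ≫ eO.hom = eK.hom ≫ q.o ∧ p.i ≫ eI.hom = eK.hom ≫ q.i

/-- A span of monomorphisms `I₂ ⟵ M ⟶ O₁` overlapping the input of `p₂` with the output of
`p₁`. -/
structure Overlap {C : Type u} [Category.{v} C] (p₂ p₁ : LinearProduction C) where
  M : C
  m₂ : M ⟶ p₂.I
  m₁ : M ⟶ p₁.O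
  [mono_m₂ : Mono m₂]
  [mono_m₁ : Mono m₁]

attribute [instance] Overlap.mono_m₂ Overlap.mono_m₁

/-- An overlap is SqPO-admissible if, for the pushout `I₂ --n₂--> N <--n₁-- O₁` of the overlap,
the composable pair `K₁ --o₁--> O₁ --n₁--> N` has a pushout complement. -/
def Overlap.IsAdmissible {C : Type u} [Category.{v} C] {p₂ p₁ : LinearProduction C}
    (m : Overlap p₂ p₁) : Prop :=
  ∃ (N : C) (n₂ : p₂.I ⟶ N) (n₁ : p₁.O ⟶ N), IsPushout m.m₂ m.m₁ n₂ n₁ ∧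
    ∃ (Kbar₁ : C) (k₁ : p₁.K ⟶ Kbar₁) (o₁' : Kbar₁ ⟶ N), IsPushout p₁.o k₁ n₁ o₁'

/-- Admissible overlaps are identified along isomorphisms of the apex that commute with the legs. -/
instance overlapSetoid {C : Type u} [Category.{v} C] (p₂ p₁ : LinearProduction C) :
    Setoid {m : Overlap p₂ p₁ // m.IsAdmissible} where
  r m m' := ∃ e : m.1.M ≅ m'.1.M, e.hom ≫ m'.1.m₂ = m.1.m₂ ∧ e.hom ≫ m'.1.m₁ = m.1.m₁
  iseqv :=
    { refl := fun _ => ⟨Iso.refl _, by simp, by simp⟩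
      symm := by
        rintro _ _ ⟨e, h₂, h₁⟩
        exact ⟨e.symm, by simp [← h₂], by simp [← h₁]⟩
      trans := by
        rintro _ _ _ ⟨e, h₂, h₁⟩ ⟨f, g₂, g₁⟩
        exact ⟨e ≪≫ f, by simp [g₂, h₂], by simp [g₁, h₁]⟩ }

/-- The set of SqPO-admissible matches of `p₂` into `p₁`. -/
def AdmissibleMatch {C : Type u} [Category.{v} C] (p₂ p₁ : LinearProduction C) : Type (max u v) :=
  Quotient (overlapSetoid p₂ p₁)

/-- The diagram of an SqPO-type concurrent composition along an overlap `m`. Its upper row is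
`O₂ ⟵ K₂ ⟶ I₂ ⟵ M ⟶ O₁ ⟵ K₁ ⟶ I₁`, its lower row is
`O₂₁ ⟵ Kbar₂ ⟶ N ⟵ Kbar₁ ⟶ I₂₁`, and the squares between the two rows are, from left to right,
a pushout, an FPC, the pushout of `m`, a pushout complement and a pushout. Below it, `K₂₁` is the
pullback of `Kbar₂ ⟶ N ⟵ Kbar₁`. -/
structure CompositionDiagram {C : Type u} [Category.{v} C] {p₂ p₁ : LinearProduction C}
    (m : Overlap p₂ p₁) where
  N : C
  n₂ : p₂.I ⟶ N
  n₁ : p₁.O ⟶ N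
  isPushout_N : IsPushout m.m₂ m.m₁ n₂ n₁
  Kbar₁ : C
  k₁ : p₁.K ⟶ Kbar₁
  o₁' : Kbar₁ ⟶ N
  isPushout_complement : IsPushout p₁.o k₁ n₁ o₁'
  I₂₁ : C
  nstar₁ : p₁.I ⟶ I₂₁
  i₁' : Kbar₁ ⟶ I₂₁
  isPushout_I : IsPushout p₁.i k₁ nstar₁ i₁'
  Kbar₂ : C
  k₂ : p₂.K ⟶ Kbar₂
  i₂' : Kbar₂ ⟶ N
  isFPC : IsFPC p₂.i n₂ k₂ i₂'
  O₂₁ : C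
  nstar₂ : p₂.O ⟶ O₂₁
  o₂' : Kbar₂ ⟶ O₂₁
  isPushout_O : IsPushout p₂.o k₂ nstar₂ o₂'
  K₂₁ : C
  i₂'' : K₂₁ ⟶ Kbar₂
  o₁'' : K₂₁ ⟶ Kbar₁
  isPullback_K : IsPullback i₂'' o₁'' i₂' o₁'

section

variable {C : Type u} [Category.{v} C] [HasPullbacks C] [Adhesive C] [HasMonoFPCs C]
  {p₂ p₁ : LinearProduction C}

/-- The composition diagram of an admissible overlap exists. -/
theorem CompositionDiagram.nonempty {m : Overlap p₂ p₁} (hm : m.IsAdmissible) :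
    Nonempty (CompositionDiagram m) := by
  obtain ⟨N, n₂, n₁, hN, Kb, k₁, o', hK⟩ := hm
  have : Mono n₂ := Adhesive.mono_of_isPushout_of_mono_right hN
  obtain ⟨D, b, d, hF⟩ := HasMonoFPCs.exists_isFPC p₂.i n₂
  exact ⟨⟨N, n₂, n₁, hN, Kb, k₁, o', hK, _, _, _, IsPushout.of_hasPushout p₁.i k₁,
    D, b, d, hF, _, _, _, IsPushout.of_hasPushout p₂.o b, _, _, _,
    IsPullback.of_hasPullback d o'⟩⟩

/-- The span `O₂₁ ⟵ K₂₁ ⟶ I₂₁` read off a composition diagram. -/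
def CompositionDiagram.composite {m : Overlap p₂ p₁} (D : CompositionDiagram m) :
    LinearProduction C where
  O := D.O₂₁
  K := D.K₂₁
  I := D.I₂₁
  o := D.i₂'' ≫ D.o₂'
  i := D.o₁'' ≫ D.i₁'
  mono_o := by
    have : Mono D.o₁' := Adhesive.mono_of_isPushout_of_mono_left D.isPushout_complement
    have : Mono D.o₂' := Adhesive.mono_of_isPushout_of_mono_left D.isPushout_O
    have : Mono D.i₂'' := (MorphismProperty.monomorphisms C).of_isPullback
      D.isPullback_K.flip (MorphismProperty.monomorphisms.infer_property D.o₁')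
    exact mono_comp _ _
  mono_i := by
    have : Mono D.n₂ := Adhesive.mono_of_isPushout_of_mono_right D.isPushout_N
    have : Mono D.i₂' := (HasMonoFPCs.mono_of_isFPC D.isFPC).2
    have : Mono D.i₁' := Adhesive.mono_of_isPushout_of_mono_left D.isPushout_I
    have : Mono D.o₁'' := (MorphismProperty.monomorphisms C).of_isPullback
      D.isPullback_K (MorphismProperty.monomorphisms.infer_property D.i₂')
    exact mono_comp _ _

/-- The composite of `p₂` with `p₁` along an admissible match: a chosen representative of the
composite, which is determined up to isomorphism. -/
noncomputable def comp (p₂ : LinearProduction C) {p₁ : LinearProduction C}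
    (m : AdmissibleMatch p₂ p₁) : LinearProduction C :=
  (Classical.choice (CompositionDiagram.nonempty (Quotient.out m).2)).composite

end

end SqPO

set_option linter.unusedSectionVars false

/-! The proof is a calculus of subobjects of two middle objects: `N`, where `p₃` meets the composite
of `p₂` and `p₁`, and `X`, where the composite of `p₃` and `p₂` meets `p₁`. Factoring through a
subobject is tested on generalized elements. Three facts carry it. Pushouts along monomorphisms are
stable under pullback, so factoring can be checked on the two pieces (`exists_lift_of_isPushout`).
The pushout of two subobjects over their intersection is their union
(`isPushout_of_isPullback_of_cover`). FPCs and pushout complements are both the largest solution of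
their problem (`IsFPC.exists_lift`, `exists_lift_of_isPushoutComplement`).

The two nestings share one object `K`, the context of `p₂` after both matches (`AssocDiagram`): `N`
is the union of `D₃₂.N` and `K`, and `X` that of `D₂₁.N` and `K`. From the left, `K` is the pushout
complement of `K₂ ⟶ O₂ ⟶ N`; from the right, it is the FPC of `D₃₂.Kbar₁ ⟶ D₃₂.I₂₁ ⟶ X`. Either way
it yields the other middle object, in which the missing matches are intersections. Since `K` is
unique from both sides, `IsAssocPair` is a one-to-one correspondence.

The composites agree because the left one, up to isomorphism, can be read off a composition diagram
for the right-hand match (`AssocDiagram.isIsomorphic_composite`). -/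

namespace SqPO

/-! ### Subobject calculus in an adhesive category. -/

section Adhesive

variable {C : Type u} [Category.{v} C]

/-- If the last leg of a pullback of a composite with a monomorphism factors, the square may be
cut along that monomorphism. -/
theorem isPullback_of_comp_mono {W X Y Y' Z : C} {f : W ⟶ X} {g : W ⟶ Y} {t : Y ⟶ Y'} {h : X ⟶ Z}
    {i : Y' ⟶ Z} [Mono t] (H : IsPullback f (g ≫ t) h i) : IsPullback f g h (t ≫ i) :=
  ⟨⟨by simpa using H.w⟩, ⟨PullbackCone.IsLimit.mk _
    (fun s => H.lift s.fst (s.snd ≫ t) (by simpa using s.condition))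
    (fun s => by simp)
    (fun s => by rw [← cancel_mono t]; simp)
    (fun s m h₁ h₂ => by apply H.hom_ext <;> simp [h₁, ← h₂])⟩⟩

theorem isPullback_id_of_mono {X Y Z : C} (h : X ⟶ Y) (u : Y ⟶ Z) [Mono u] :
    IsPullback h (𝟙 X) u (h ≫ u) := by
  have := (IsPullback.of_id_snd (f := h)).paste_horiz (IsKernelPair.id_of_mono u)
  rwa [Category.comp_id] at this

theorem isPullback_comp_mono {W X Y Z Z' : C} {f : W ⟶ X} {g : W ⟶ Y} {h : X ⟶ Z} {i : Y ⟶ Z}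
    (H : IsPullback f g h i) (u : Z ⟶ Z') [Mono u] : IsPullback f g (h ≫ u) (i ≫ u) :=
  ⟨⟨by simp [H.w_assoc]⟩, ⟨PullbackCone.IsLimit.mk _
    (fun s => H.lift s.fst s.snd (by rw [← cancel_mono u]; simpa using s.condition))
    (fun s => by simp) (fun s => by simp)
    (fun s m h₁ h₂ => by apply H.hom_ext <;> simp [h₁, h₂])⟩⟩

/-- A commutative square with two parallel monomorphic legs is a pullback as soon as morphisms lift
through the upper one. -/
theorem isPullback_of_lift {W X Y Z : C} {f : W ⟶ X} {g : W ⟶ Y} {h : X ⟶ Z} {i : Y ⟶ Z}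
    [Mono f] [Mono i] (w : f ≫ h = g ≫ i)
    (H : ∀ {T : C} (x : T ⟶ X) (y : T ⟶ Y), x ≫ h = y ≫ i → ∃ l, l ≫ f = x) :
    IsPullback f g h i := by
  refine ⟨⟨w⟩, ⟨PullbackCone.IsLimit.mk _
    (fun s => (H s.fst s.snd s.condition).choose)
    (fun s => (H s.fst s.snd s.condition).choose_spec) (fun s => ?_) (fun s m h₁ h₂ => ?_)⟩⟩
  · rw [← cancel_mono i, Category.assoc, ← w, ← Category.assoc,
      (H s.fst s.snd s.condition).choose_spec, s.condition]
  · rw [← cancel_mono f, h₁, (H s.fst s.snd s.condition).choose_spec]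

/-- Final pullback complements of monomorphisms in terms of generalized elements. -/
theorem IsFPC.exists_lift [HasPullbacks C] {A B D X T : C} {a : A ⟶ B} {c : B ⟶ X} {b : A ⟶ D}
    {d : D ⟶ X}
    (H : IsFPC a c b d) (z : T ⟶ X)
    (hB : ∀ {P : C} (p : P ⟶ T) (x : P ⟶ B), p ≫ z = x ≫ c → ∃ l, l ≫ a = x) :
    ∃ l, l ≫ d = z := by
  have s := IsPullback.of_hasPullback c z
  obtain ⟨l, hl⟩ := hB _ _ s.w.symm
  obtain ⟨w, hw, -⟩ := H.existsUnique_lift _ _ z l s hl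
  exact ⟨w, hw.1⟩

/-- Converse of `IsFPC.exists_lift`: as `d` is a monomorphism, uniqueness and compatibility with `y`
and `w` come for free. -/
theorem isFPC_of_exists_lift {A B D X : C} {a : A ⟶ B} {c : B ⟶ X} {b : A ⟶ D} {d : D ⟶ X}
    [Mono d] (H : IsPullback a b c d)
    (hl : ∀ {T : C} (z : T ⟶ X), (∀ {P : C} (p : P ⟶ T) (x : P ⟶ B), p ≫ z = x ≫ c →
      ∃ l, l ≫ a = x) → ∃ l, l ≫ d = z) : IsFPC a c b d := by
  refine ⟨H, fun {P T} x y z w hp hw => ?_⟩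
  obtain ⟨l, hl⟩ := hl z (fun p x' hp' => ⟨hp.lift x' p hp'.symm ≫ w, by simp [hw]⟩)
  refine ⟨l, ⟨hl, ?_⟩, fun l' h' => by rw [← cancel_mono d, h'.1, hl]⟩
  rw [← cancel_mono d]
  simp [hl, ← H.w, ← hp.w, reassoc_of% hw]

variable [Adhesive C]

/-- Pushouts along monomorphisms are stable under pullback. -/
theorem isPushout_of_isPullback {W X Y Z W' X' Y' Z' : C} {f : W ⟶ X} {g : W ⟶ Y} {h : X ⟶ Z}
    {i : Y ⟶ Z} [Mono f] (H : IsPushout f g h i) {f' : W' ⟶ X'} {g' : W' ⟶ Y'} {h' : X' ⟶ Z'}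
    {i' : Y' ⟶ Z'} {αW : W' ⟶ W} {αX : X' ⟶ X} {αY : Y' ⟶ Y} {αZ : Z' ⟶ Z}
    (hX : IsPullback h' αX αZ h) (hY : IsPullback i' αY αZ i) (hf : IsPullback f' αW αX f)
    (w : f' ≫ h' = g' ≫ i') (wg : g' ≫ αY = αW ≫ g) : IsPushout f' g' h' i' := by
  refine ((Adhesive.van_kampen H) f' g' h' i' αW αX αY αZ hf ?_ hX.toCommSq hY.toCommSq ⟨w⟩).2
    ⟨hX, hY⟩
  refine IsPullback.of_right ?_ wg hY
  rw [← w, ← H.w]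
  exact hf.paste_horiz hX

/-- Unions of subobjects are effective: a pullback of two monomorphisms is a pushout if every
subobject of the target that contains both is the whole target. -/
theorem isPushout_of_isPullback_of_cover {W X Y Z : C} {f : W ⟶ X} {g : W ⟶ Y} {h : X ⟶ Z}
    {i : Y ⟶ Z} [Mono h] [Mono i] (H : IsPullback f g h i)
    (hD : ∀ {D : C} (d : D ⟶ Z) [Mono d] (x : X ⟶ D) (y : Y ⟶ D), x ≫ d = h → y ≫ d = i →
      ∃ l, l ≫ d = 𝟙 Z) : IsPushout f g h i := by
  have hm := Adhesive.desc_mono_of_mono (a := h) (b := i)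
  -- The union of `X` and `Y` is itself a subobject containing both, so its inclusion is a split
  -- epimorphism as well as a monomorphism.
  obtain ⟨l, hl⟩ := hD _ (pushout.inl _ _) (pushout.inr _ _) (pushout.inl_desc _ _ _)
    (pushout.inr_desc _ _ pullback.condition)
  have : IsIso (pushout.desc h i pullback.condition) :=
    ⟨l, by rw [← cancel_mono (pushout.desc h i pullback.condition)]; simp [hl], hl⟩
  exact (IsPushout.of_hasPushout (pullback.fst h i) (pullback.snd h i)).of_iso
    H.isoPullback.symm (Iso.refl _) (Iso.refl _) (asIso (pushout.desc h i pullback.condition))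
    (by simp) (by simp) ((pushout.inl_desc _ _ _).trans (by simp))
    ((pushout.inr_desc _ _ _).trans (by simp))

/-- The morphism from the pushout of a pullback of monomorphisms is a monomorphism. -/
theorem mono_of_isPushout_of_isPullback {W X Y P Z : C} {f : W ⟶ X} {g : W ⟶ Y} {h : X ⟶ P}
    {i : Y ⟶ P} {u : P ⟶ Z} (hP : IsPushout f g h i) [Mono (h ≫ u)] [Mono (i ≫ u)]
    (H : IsPullback f g (h ≫ u) (i ≫ u)) : Mono u := by
  have hm := Adhesive.desc_mono_of_mono (a := h ≫ u) (b := i ≫ u)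
  have hQ : IsPushout f g
      (pushout.inl (pullback.fst (h ≫ u) (i ≫ u)) (pullback.snd (h ≫ u) (i ≫ u)))
      (pushout.inr (pullback.fst (h ≫ u) (i ≫ u)) (pullback.snd (h ≫ u) (i ≫ u))) :=
    (IsPushout.of_hasPushout _ _).of_iso H.isoPullback.symm (Iso.refl _) (Iso.refl _)
      (Iso.refl _) (by simp) (by simp) (by simp) (by simp)
  have : u = (hP.isoIsPushout _ _ hQ).hom ≫ pushout.desc (h ≫ u) (i ≫ u) pullback.condition := by
    apply hP.hom_ext
    · rw [hP.inl_isoIsPushout_hom_assoc]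
      exact (pushout.inl_desc _ _ _).symm
    · rw [hP.inr_isoIsPushout_hom_assoc]
      exact (pushout.inr_desc _ _ _).symm
  rw [this]
  exact mono_comp _ _

/-- A pushout complement restricts along a monomorphism. -/
theorem exists_isPushoutComplement_of_mono {W X Y Z' Z : C} {f : W ⟶ X} {g : W ⟶ Y} {h : X ⟶ Z'}
    {u : Z' ⟶ Z} {i : Y ⟶ Z} [Mono f] [Mono u] (H : IsPushout f g (h ≫ u) i) :
    ∃ (Y' : C) (g' : W ⟶ Y') (i' : Y' ⟶ Z'), IsPushout f g' h i' := by
  have sY := IsPullback.of_hasPullback u i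
  exact ⟨_, sY.lift (f ≫ h) g (by simpa using H.w), _, isPushout_of_isPullback H
    (isPullback_id_of_mono h u) sY IsPullback.of_id_snd (by simp) (by simp)⟩

variable [HasPullbacks C]

/-- Whether a morphism factors through a monomorphism can be tested locally on a pushout along a
monomorphism. -/
theorem exists_lift_of_isPushout {W X Y Z T D E : C} {f : W ⟶ X} {g : W ⟶ Y} {h : X ⟶ Z}
    {i : Y ⟶ Z} [Mono f] (H : IsPushout f g h i) (z : T ⟶ Z) (d : D ⟶ E) [Mono d] (e : T ⟶ E)
    (hX : ∀ {P : C} (p : P ⟶ T) (x : P ⟶ X), p ≫ z = x ≫ h → ∃ l, l ≫ d = p ≫ e)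
    (hY : ∀ {P : C} (p : P ⟶ T) (y : P ⟶ Y), p ≫ z = y ≫ i → ∃ l, l ≫ d = p ≫ e) :
    ∃ l, l ≫ d = e := by
  have sX := IsPullback.of_hasPullback z h
  have sY := IsPullback.of_hasPullback z i
  -- Pulled back along `z`, the pushout exhibits `T` as a pushout of its two parts; the local lifts
  -- agree on the overlap because `d` is a monomorphism.
  obtain ⟨W', f', g', _, _, _, H'⟩ := (Adhesive.van_kampen H).exists_cube_filling sX sY
  obtain ⟨lX, hlX⟩ := hX _ _ sX.w
  obtain ⟨lY, hlY⟩ := hY _ _ sY.w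
  refine ⟨H'.desc lX lY ?_, ?_⟩
  · rw [← cancel_mono d, Category.assoc, Category.assoc, hlX, hlY, H'.w_assoc]
  · apply H'.hom_ext <;> simp [hlX, hlY]

/-- Pushout complements of monomorphisms are final pullback complements. -/
theorem exists_lift_of_isPushoutComplement {W X Y Z T : C} {f : W ⟶ X} {g : W ⟶ Y} {h : X ⟶ Z}
    {i : Y ⟶ Z} [Mono f] (H : IsPushout f g h i) (z : T ⟶ Z)
    (hX : ∀ {P : C} (p : P ⟶ T) (x : P ⟶ X), p ≫ z = x ≫ h → ∃ l, l ≫ f = x) :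
    ∃ l, l ≫ i = z := by
  have : Mono i := Adhesive.mono_of_isPushout_of_mono_left H
  refine exists_lift_of_isPushout H z i z (fun p x hp => ?_) (fun p y hp => ⟨y, hp.symm⟩)
  obtain ⟨l, rfl⟩ := hX p x hp
  exact ⟨l ≫ g, by simp [hp, H.w]⟩

end Adhesive

end SqPO

/-! ### Uniqueness of complements and of composites. -/

namespace SqPO

variable {C : Type u} [Category.{v} C]

section Uniqueness

variable [HasPullbacks C]

/-- Final pullback complements of monomorphisms are unique up to isomorphism. -/
theorem exists_iso_of_isFPC {A B X D X' D' : C} {a : A ⟶ B} {c : B ⟶ X} {b : A ⟶ D}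
    {d : D ⟶ X} {c' : B ⟶ X'} {b' : A ⟶ D'} {d' : D' ⟶ X'} [HasMonoFPCs C] [Mono a]
    [Mono c] [Mono c']
    (H : IsFPC a c b d) (H' : IsFPC a c' b' d') (e : X ≅ X') (he : c ≫ e.hom = c') :
    ∃ k : D ≅ D', k.hom ≫ d' = d ≫ e.hom ∧ b ≫ k.hom = b' := by
  have : Mono d := (HasMonoFPCs.mono_of_isFPC H).2
  have : Mono d' := (HasMonoFPCs.mono_of_isFPC H').2
  obtain ⟨k, hk⟩ := H'.exists_lift (d ≫ e.hom) (fun p x hp =>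
    ⟨H.isPullback.lift x p (by rw [← cancel_mono e.hom]; simp [hp, he]), by simp⟩)
  obtain ⟨l, hl⟩ := H.exists_lift (d' ≫ e.inv) (fun p x hp =>
    ⟨H'.isPullback.lift x p (by rw [← he, ← Category.assoc, ← hp]; simp), by simp⟩)
  refine ⟨⟨k, l, ?_, ?_⟩, hk, ?_⟩
  · rw [← cancel_mono d]; simp [hl, reassoc_of% hk]
  · rw [← cancel_mono d']; simp [hk, reassoc_of% hl]
  · rw [← cancel_mono d']
    simp [hk, ← H'.isPullback.w, ← he, reassoc_of% H.isPullback.w]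

variable [Adhesive C]

/-- Pushout complements of monomorphisms are unique up to isomorphism. -/
theorem exists_iso_of_isPushoutComplement {W X Y Y' Z Z' : C} {f : W ⟶ X} {g : W ⟶ Y}
    {h : X ⟶ Z} {i : Y ⟶ Z} {g' : W ⟶ Y'} {h' : X ⟶ Z'} {i' : Y' ⟶ Z'} [Mono f] [Mono g] [Mono g']
    (H : IsPushout f g h i) (H' : IsPushout f g' h' i') (e : Z ≅ Z') (he : h ≫ e.hom = h') :
    ∃ k : Y ≅ Y', k.hom ≫ i' = i ≫ e.hom ∧ g ≫ k.hom = g' := by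
  have : Mono i := Adhesive.mono_of_isPushout_of_mono_left H
  have : Mono i' := Adhesive.mono_of_isPushout_of_mono_left H'
  have P := Adhesive.isPullback_of_isPushout_of_mono_left H
  have P' := Adhesive.isPullback_of_isPushout_of_mono_left H'
  obtain ⟨k, hk⟩ := exists_lift_of_isPushoutComplement H' (i ≫ e.hom) (fun p x hp =>
    ⟨P.lift x p (by rw [← cancel_mono e.hom]; simp [hp, he]), by simp⟩)
  obtain ⟨l, hl⟩ := exists_lift_of_isPushoutComplement H (i' ≫ e.inv) (fun p x hp =>
    ⟨P'.lift x p (by rw [← he, ← Category.assoc, ← hp]; simp), by simp⟩)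
  refine ⟨⟨k, l, ?_, ?_⟩, hk, ?_⟩
  · rw [← cancel_mono i]; simp [hl, reassoc_of% hk]
  · rw [← cancel_mono i']; simp [hk, reassoc_of% hl]
  · rw [← cancel_mono i']
    simp [hk, ← H'.w, ← he, reassoc_of% H.w]

end Uniqueness

namespace CompositionDiagram

section Mono

variable [Adhesive C] {p₂ p₁ : LinearProduction C} {m : Overlap p₂ p₁} (D : CompositionDiagram m)

instance : Mono D.n₂ := Adhesive.mono_of_isPushout_of_mono_right D.isPushout_N
instance : Mono D.n₁ := Adhesive.mono_of_isPushout_of_mono_left D.isPushout_N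
instance : Mono D.o₁' := Adhesive.mono_of_isPushout_of_mono_left D.isPushout_complement
instance : Mono D.i₁' := Adhesive.mono_of_isPushout_of_mono_left D.isPushout_I
instance : Mono D.o₂' := Adhesive.mono_of_isPushout_of_mono_left D.isPushout_O

instance : Mono D.k₁ := by
  have : Mono (D.k₁ ≫ D.o₁') := by rw [← D.isPushout_complement.w]; infer_instance
  exact mono_of_mono _ D.o₁'

instance : Mono D.nstar₁ := Adhesive.mono_of_isPushout_of_mono_right D.isPushout_I

instance : Mono D.i₂'' := (MorphismProperty.monomorphisms C).of_isPullback
  D.isPullback_K.flip (MorphismProperty.monomorphisms.infer_property D.o₁')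

variable [HasMonoFPCs C]

instance : Mono D.i₂' := (HasMonoFPCs.mono_of_isFPC D.isFPC).2
instance : Mono D.k₂ := (HasMonoFPCs.mono_of_isFPC D.isFPC).1
instance : Mono D.nstar₂ := Adhesive.mono_of_isPushout_of_mono_right D.isPushout_O

instance : Mono D.o₁'' := (MorphismProperty.monomorphisms C).of_isPullback
  D.isPullback_K (MorphismProperty.monomorphisms.infer_property D.i₂')

end Mono

variable [HasPullbacks C] [Adhesive C] [HasMonoFPCs C] {p₂ p₁ : LinearProduction C}
  {m : Overlap p₂ p₁}

/-- Composites along an overlap are unique up to isomorphism. -/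
theorem isIsomorphic_composite (D D' : CompositionDiagram m) :
    D.composite.IsIsomorphic D'.composite := by
  let e := D.isPushout_N.isoIsPushout _ _ D'.isPushout_N
  obtain ⟨k, hk, hk'⟩ := exists_iso_of_isPushoutComplement D.isPushout_complement
    D'.isPushout_complement e (by simp [e])
  obtain ⟨l, hl, hl'⟩ := exists_iso_of_isFPC D.isFPC D'.isFPC e (by simp [e])
  let eI : D.I₂₁ ≅ D'.I₂₁ :=
    ⟨D.isPushout_I.desc D'.nstar₁ (k.hom ≫ D'.i₁') (by simp [reassoc_of% hk', D'.isPushout_I.w]),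
      D'.isPushout_I.desc D.nstar₁ (k.inv ≫ D.i₁') (by simp [← hk', D.isPushout_I.w]),
      by apply D.isPushout_I.hom_ext <;> simp, by apply D'.isPushout_I.hom_ext <;> simp⟩
  let eO : D.O₂₁ ≅ D'.O₂₁ :=
    ⟨D.isPushout_O.desc D'.nstar₂ (l.hom ≫ D'.o₂') (by simp [reassoc_of% hl', D'.isPushout_O.w]),
      D'.isPushout_O.desc D.nstar₂ (l.inv ≫ D.o₂') (by simp [← hl', D.isPushout_O.w]),
      by apply D.isPushout_O.hom_ext <;> simp, by apply D'.isPushout_O.hom_ext <;> simp⟩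
  have hli : l.inv ≫ D.i₂' = D'.i₂' ≫ e.inv := by simp [Iso.inv_comp_eq, reassoc_of% hl]
  have hki : k.inv ≫ D.o₁' = D'.o₁' ≫ e.inv := by simp [Iso.inv_comp_eq, reassoc_of% hk]
  let eK : D.K₂₁ ≅ D'.K₂₁ :=
    ⟨D'.isPullback_K.lift (D.i₂'' ≫ l.hom) (D.o₁'' ≫ k.hom)
        (by simp [hl, hk, reassoc_of% D.isPullback_K.w]),
      D.isPullback_K.lift (D'.i₂'' ≫ l.inv) (D'.o₁'' ≫ k.inv)
        (by simp [hli, hki, reassoc_of% D'.isPullback_K.w]),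
      by apply D.isPullback_K.hom_ext <;> simp, by apply D'.isPullback_K.hom_ext <;> simp⟩
  exact ⟨eO, eK, eI, by simp [composite, eO, eK], by simp [composite, eI, eK]⟩

end CompositionDiagram

end SqPO

/-! ### The common refinement of the two nestings. -/

namespace SqPO

variable {C : Type u} [Category.{v} C] {p₁ p₂ p₃ : LinearProduction C}
  {m₂₁ : Overlap p₂ p₁} {m₃₂ : Overlap p₃ p₂}

/-- The common refinement of two nested compositions of `p₃`, `p₂` and `p₁`. Here `N` is the middle
object of the composition of `p₃` with the composite of `p₂` and `p₁`, and `X` is the middle object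
of the composition of the composite of `p₃` and `p₂` with `p₁`. The context `K` glues the
context of `p₂` in `D₂₁` with the one in `D₃₂`. -/
structure AssocDiagram (D₂₁ : CompositionDiagram m₂₁) (D₃₂ : CompositionDiagram m₃₂) {N X : C}
    (n₃ : p₃.I ⟶ N) (n₂₁ : D₂₁.O₂₁ ⟶ N) (x₃₂ : D₃₂.I₂₁ ⟶ X) (x₁ : p₁.O ⟶ X) where
  K : C
  s : D₂₁.Kbar₂ ⟶ K
  t : D₃₂.Kbar₁ ⟶ K
  a : K ⟶ N
  b : K ⟶ X
  u : D₃₂.N ⟶ N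
  v : D₂₁.N ⟶ X
  isPushout_a : IsPushout D₃₂.o₁' t u a
  isPushout_b : IsPushout D₂₁.i₂' s v b
  n₂_u : D₃₂.n₂ ≫ u = n₃
  n₁_u : D₃₂.n₁ ≫ u = D₂₁.nstar₂ ≫ n₂₁
  n₂_v : D₂₁.n₂ ≫ v = D₃₂.nstar₁ ≫ x₃₂
  n₁_v : D₂₁.n₁ ≫ v = x₁
  k₂_s : D₂₁.k₂ ≫ s = D₃₂.k₁ ≫ t
  s_a : s ≫ a = D₂₁.o₂' ≫ n₂₁
  t_b : t ≫ b = D₃₂.i₁' ≫ x₃₂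

namespace AssocDiagram

variable [HasPullbacks C] [Adhesive C] [HasMonoFPCs C]
  {D₂₁ : CompositionDiagram m₂₁} {D₃₂ : CompositionDiagram m₃₂} {N X : C}
  {n₃ : p₃.I ⟶ N} {n₂₁ : D₂₁.O₂₁ ⟶ N} {x₃₂ : D₃₂.I₂₁ ⟶ X} {x₁ : p₁.O ⟶ X}

instance (A : AssocDiagram D₂₁ D₃₂ n₃ n₂₁ x₃₂ x₁) : Mono A.a :=
  Adhesive.mono_of_isPushout_of_mono_left A.isPushout_a
instance (A : AssocDiagram D₂₁ D₃₂ n₃ n₂₁ x₃₂ x₁) : Mono A.b :=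
  Adhesive.mono_of_isPushout_of_mono_left A.isPushout_b

instance (A : AssocDiagram D₂₁ D₃₂ n₃ n₂₁ x₃₂ x₁) [Mono n₂₁] : Mono A.s := by
  have : Mono (A.s ≫ A.a) := by rw [A.s_a]; infer_instance
  exact mono_of_mono _ A.a

instance (A : AssocDiagram D₂₁ D₃₂ n₃ n₂₁ x₃₂ x₁) [Mono x₃₂] : Mono A.t := by
  have : Mono (A.t ≫ A.b) := by rw [A.t_b]; infer_instance
  exact mono_of_mono _ A.b

instance (A : AssocDiagram D₂₁ D₃₂ n₃ n₂₁ x₃₂ x₁) [Mono x₃₂] : Mono A.u :=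
  Adhesive.mono_of_isPushout_of_mono_right A.isPushout_a
instance (A : AssocDiagram D₂₁ D₃₂ n₃ n₂₁ x₃₂ x₁) [Mono n₂₁] : Mono A.v :=
  Adhesive.mono_of_isPushout_of_mono_right A.isPushout_b

theorem isPullback_a (A : AssocDiagram D₂₁ D₃₂ n₃ n₂₁ x₃₂ x₁) : IsPullback D₃₂.o₁' A.t A.u A.a :=
  Adhesive.isPullback_of_isPushout_of_mono_left A.isPushout_a

theorem isPullback_b (A : AssocDiagram D₂₁ D₃₂ n₃ n₂₁ x₃₂ x₁) : IsPullback D₂₁.i₂' A.s A.v A.b :=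
  Adhesive.isPullback_of_isPushout_of_mono_left A.isPushout_b

/-- The pushout over `K₂ ⟶ O₂` with corner `N` factors through both contexts of `p₂`; cancelling the
`D₂₁` half leaves this square. -/
theorem isPushout_s (A : AssocDiagram D₂₁ D₃₂ n₃ n₂₁ x₃₂ x₁) : IsPushout D₂₁.o₂' A.s n₂₁ A.a := by
  have h := D₃₂.isPushout_complement.paste_vert A.isPushout_a
  rw [A.n₁_u, ← A.k₂_s] at h
  exact h.of_top A.s_a.symm D₂₁.isPushout_O

theorem isPullback_s (A : AssocDiagram D₂₁ D₃₂ n₃ n₂₁ x₃₂ x₁) : IsPullback D₂₁.o₂' A.s n₂₁ A.a :=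
  Adhesive.isPullback_of_isPushout_of_mono_left A.isPushout_s

/-- An element of `D₃₂.I₂₁` lying in `K` is tested on `I₂` and `D₃₂.Kbar₁`. On `I₂` it lies in both
`D₂₁.N` and `K`, hence in `D₂₁.Kbar₂`, hence in `K₂`. -/
theorem isPullback_t (A : AssocDiagram D₂₁ D₃₂ n₃ n₂₁ x₃₂ x₁) : IsPullback D₃₂.i₁' A.t x₃₂ A.b := by
  refine isPullback_of_lift A.t_b.symm fun {T} x y h => ?_
  refine exists_lift_of_isPushout D₃₂.isPushout_I x D₃₂.i₁' x (fun {P} p q hq => ?_)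
    (fun p q hq => ⟨q, hq.symm⟩)
  let r := A.isPullback_b.lift (q ≫ D₂₁.n₂) (p ≫ y) (by
    simp [A.n₂_v, ← reassoc_of% hq, h])
  refine ⟨D₂₁.isFPC.isPullback.lift q r (by simp [r]) ≫ D₃₂.k₁, ?_⟩
  simp [← D₃₂.isPushout_I.w, hq]

/-- This recovers `K` from `X`. Only the part of `z` in `D₂₁.N` needs an argument: its elements from
`I₂` lie in `K₂`, so finality of `D₂₁.Kbar₂` applies. -/
theorem isFPC_t (A : AssocDiagram D₂₁ D₃₂ n₃ n₂₁ x₃₂ x₁) : IsFPC D₃₂.i₁' x₃₂ A.t A.b := by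
  refine isFPC_of_exists_lift A.isPullback_t fun z hz => ?_
  refine exists_lift_of_isPushout A.isPushout_b z A.b z (fun p x hp => ?_)
    (fun p y hp => ⟨y, hp.symm⟩)
  obtain ⟨l, rfl⟩ := D₂₁.isFPC.exists_lift x (fun p' q hq => by
    obtain ⟨l, hl⟩ := hz (p' ≫ p) (q ≫ D₃₂.nstar₁) (by
      simp [hp, reassoc_of% hq, A.n₂_v])
    exact ⟨(Adhesive.isPullback_of_isPushout_of_mono_left D₃₂.isPushout_I).lift q l hl.symm,
      by simp⟩)
  exact ⟨l ≫ A.s, by simp [hp, A.isPushout_b.w]⟩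

/-- As `D₃₂.N` embeds in `N`, the match can be read off as an intersection in `N`; this gives its
uniqueness. -/
theorem isPullback_m₃₂ (A : AssocDiagram D₂₁ D₃₂ n₃ n₂₁ x₃₂ x₁)
    [Mono x₃₂] : IsPullback m₃₂.m₂ m₃₂.m₁ n₃ (D₂₁.nstar₂ ≫ n₂₁) := by
  have := isPullback_comp_mono
    (Adhesive.isPullback_of_isPushout_of_mono_left D₃₂.isPushout_N) A.u
  rwa [A.n₁_u, A.n₂_u] at this

theorem isPullback_m₂₁ (A : AssocDiagram D₂₁ D₃₂ n₃ n₂₁ x₃₂ x₁)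
    [Mono n₂₁] : IsPullback m₂₁.m₂ m₂₁.m₁ (D₃₂.nstar₁ ≫ x₃₂) x₁ := by
  rw [← A.n₁_v, ← A.n₂_v]
  exact isPullback_comp_mono
    (Adhesive.isPullback_of_isPushout_of_mono_left D₂₁.isPushout_N) A.v

/-- If `I₃` and `O₂₁` cover `N`, then `D₃₂.I₂₁` and `O₁` cover `X`. A subobject containing the
latter two contains `D₂₁.N`, the union of `I₂` and `O₁`; it remains to show that it contains `K`. -/
theorem isPushout_x (A : AssocDiagram D₂₁ D₃₂ n₃ n₂₁ x₃₂ x₁)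
    [Mono x₃₂] [Mono x₁] {M M' : C} {l₃ : M ⟶ p₃.I} {l₂₁ : M ⟶ D₂₁.O₂₁} [Mono l₃]
    (H : IsPushout l₃ l₂₁ n₃ n₂₁) {l₃₂ : M' ⟶ D₃₂.I₂₁} {l₁ : M' ⟶ p₁.O}
    (H' : IsPullback l₃₂ l₁ x₃₂ x₁) : IsPushout l₃₂ l₁ x₃₂ x₁ := by
  refine isPushout_of_isPullback_of_cover H' fun {D} d _ x y hx hy => ?_
  obtain ⟨v', hv⟩ := exists_lift_of_isPushout D₂₁.isPushout_N (𝟙 _) d A.v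
    (fun p q hq => ⟨q ≫ D₃₂.nstar₁ ≫ x, by simp at hq; simp [hx, hq, A.n₂_v]⟩)
    (fun p q hq => ⟨q ≫ y, by simp at hq; simp [hy, hq, A.n₁_v]⟩)
  -- `K` is cut up by the cover of `N` although the factorization is sought over `X`: its part in
  -- `I₃` lies in `D₃₂.Kbar₁`, its part in `O₂₁` in `D₂₁.Kbar₂`.
  obtain ⟨b', hb⟩ := exists_lift_of_isPushout H A.a d A.b
    (fun p q hq => ⟨A.isPullback_a.lift (q ≫ D₃₂.n₂) p (by simp [A.n₂_u, hq]) ≫ D₃₂.i₁' ≫ x,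
      by simp [hx, ← A.t_b]⟩)
    (fun p q hq => ⟨A.isPullback_s.lift q p hq.symm ≫ D₂₁.i₂' ≫ v',
      by simp [hv, A.isPushout_b.w]⟩)
  exact exists_lift_of_isPushout A.isPushout_b (𝟙 _) d (𝟙 _)
    (fun p q hq => ⟨q ≫ v', by simp [hv, ← hq]⟩) (fun p q hq => ⟨q ≫ b', by simp [hb, ← hq]⟩)

theorem isPushout_n (A : AssocDiagram D₂₁ D₃₂ n₃ n₂₁ x₃₂ x₁)
    [Mono n₃] [Mono n₂₁] {M M' : C} {l₃ : M ⟶ p₃.I} {l₂₁ : M ⟶ D₂₁.O₂₁}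
    (H : IsPullback l₃ l₂₁ n₃ n₂₁) {l₃₂ : M' ⟶ D₃₂.I₂₁} {l₁ : M' ⟶ p₁.O} [Mono l₃₂]
    (H' : IsPushout l₃₂ l₁ x₃₂ x₁) : IsPushout l₃ l₂₁ n₃ n₂₁ := by
  refine isPushout_of_isPullback_of_cover H fun {D} d _ x y hx hy => ?_
  obtain ⟨u', hu⟩ := exists_lift_of_isPushout D₃₂.isPushout_N (𝟙 _) d A.u
    (fun p q hq => ⟨q ≫ x, by simp at hq; simp [hx, hq, A.n₂_u]⟩)
    (fun p q hq => ⟨q ≫ D₂₁.nstar₂ ≫ y, by simp at hq; simp [hy, hq, A.n₁_u]⟩)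
  obtain ⟨a', ha⟩ := exists_lift_of_isPushout H' A.b d A.a
    (fun p q hq => ⟨A.isPullback_t.lift q p hq.symm ≫ D₃₂.o₁' ≫ u',
      by simp [hu, A.isPushout_a.w]⟩)
    (fun p q hq => ⟨A.isPullback_b.lift (q ≫ D₂₁.n₁) p (by simp [A.n₁_v, hq]) ≫ D₂₁.o₂' ≫ y,
      by simp [hy, ← A.s_a]⟩)
  exact exists_lift_of_isPushout A.isPushout_a (𝟙 _) d (𝟙 _)
    (fun p q hq => ⟨q ≫ u', by simp [hu, ← hq]⟩) (fun p q hq => ⟨q ≫ a', by simp [ha, ← hq]⟩)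

/-- `B` meets `O₂₁` in `D₂₁.K₂₁`, inside `D₂₁.Kbar₂`, so it lies in the complement `K`; pulling `G`
back to `K` gives the pushout. -/
theorem exists_isPushout_r (A : AssocDiagram D₂₁ D₃₂ n₃ n₂₁ x₃₂ x₁)
    {B : C} {g : D₂₁.K₂₁ ⟶ B} {o : B ⟶ N}
    (G : IsPushout (D₂₁.i₂'' ≫ D₂₁.o₂') g n₂₁ o) :
    ∃ r : B ⟶ A.K, r ≫ A.a = o ∧ IsPushout D₂₁.i₂'' g A.s r := by
  obtain ⟨r, rfl⟩ := exists_lift_of_isPushoutComplement A.isPushout_s o (fun p x hp =>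
    ⟨(Adhesive.isPullback_of_isPushout_of_mono_left G).lift x p hp.symm ≫ D₂₁.i₂'', by simp⟩)
  refine ⟨r, rfl, isPushout_of_isPullback G A.isPullback_s.flip (isPullback_id_of_mono r A.a)
    (isPullback_id_of_mono _ _) ?_ (by simp)⟩
  rw [← cancel_mono A.a]
  simpa [A.s_a] using G.w

/-- Carries admissibility from left to right: the context of `p₁` in `X` is `D₂₁.Kbar₁` glued to `B`
along `D₂₁.K₂₁`. -/
theorem exists_isPushout_complement_x (A : AssocDiagram D₂₁ D₃₂ n₃ n₂₁ x₃₂ x₁)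
    {B L : C} {g : D₂₁.K₂₁ ⟶ B} {r : B ⟶ A.K}
    (G : IsPushout D₂₁.i₂'' g A.s r) {j : D₂₁.Kbar₁ ⟶ L} {h : B ⟶ L}
    (H : IsPushout D₂₁.o₁'' g j h) :
    ∃ o : L ⟶ X, h ≫ o = r ≫ A.b ∧ IsPushout D₂₁.o₁' j A.v o := by
  have G' := G.paste_horiz A.isPushout_b
  rw [D₂₁.isPullback_K.w] at G'
  exact ⟨_, H.inr_desc _ _ _, G'.of_left' H⟩

/-- Carries admissibility from right to left, with `B` the intersection of `K` and `L` in `X`. -/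
theorem exists_isPushout_complement_n (A : AssocDiagram D₂₁ D₃₂ n₃ n₂₁ x₃₂ x₁)
    [Mono n₂₁] {L : C} {k : p₁.K ⟶ L} {o : L ⟶ X}
    (G : IsPushout p₁.o k x₁ o) :
    ∃ (B : C) (g : D₂₁.K₂₁ ⟶ B) (o : B ⟶ N), IsPushout (D₂₁.i₂'' ≫ D₂₁.o₂') g n₂₁ o := by
  have : Mono o := Adhesive.mono_of_isPushout_of_mono_left G
  obtain ⟨j, hj⟩ := exists_lift_of_isPushoutComplement G (D₂₁.o₁' ≫ A.v) (fun p x hp =>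
    ⟨(Adhesive.isPullback_of_isPushout_of_mono_left D₂₁.isPushout_complement).lift x p
      (by rw [← cancel_mono A.v]; simp [A.n₁_v, hp]), by simp⟩)
  have hk : D₂₁.k₁ ≫ j = k := by
    rw [← cancel_mono o, ← G.w]
    simp [hj, ← A.n₁_v, D₂₁.isPushout_complement.w_assoc]
  rw [← A.n₁_v, ← hk] at G
  have G' := G.of_top hj.symm D₂₁.isPushout_complement
  have sB := IsPullback.of_hasPullback A.b o
  have := isPushout_of_isPullback (f' := D₂₁.i₂'')
    (g' := sB.lift (D₂₁.i₂'' ≫ A.s) (D₂₁.o₁'' ≫ j) (by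
      simp [hj, ← A.isPushout_b.w, D₂₁.isPullback_K.w_assoc])) G' A.isPullback_b.flip sB
      D₂₁.isPullback_K (by simp) (by simp)
  exact ⟨_, _, _, this.paste_horiz A.isPushout_s⟩

end AssocDiagram

end SqPO

/-! ### Existence and uniqueness of the refinement from either side. -/

namespace SqPO

variable {C : Type u} [Category.{v} C] {p₁ p₂ p₃ : LinearProduction C}
  {m₂₁ : Overlap p₂ p₁} {m₃₂ : Overlap p₃ p₂}

variable [HasPullbacks C] [Adhesive C] [HasMonoFPCs C]

/-- Pushing out along `D₂₁.i₂''` first produces `K`, and with it the complement needed for a match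
of `p₃` into `p₂`. -/
theorem CompositionDiagram.exists_isPushout_complement_nstar₂ (D₂₁ : CompositionDiagram m₂₁)
    {N B : C} {n₂₁ : D₂₁.O₂₁ ⟶ N} {g : D₂₁.K₂₁ ⟶ B} {o : B ⟶ N}
    (G : IsPushout (D₂₁.i₂'' ≫ D₂₁.o₂') g n₂₁ o) :
    ∃ (K : C) (s : D₂₁.Kbar₂ ⟶ K) (a : K ⟶ N), IsPushout D₂₁.o₂' s n₂₁ a ∧
      IsPushout p₂.o (D₂₁.k₂ ≫ s) (D₂₁.nstar₂ ≫ n₂₁) a :=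
  have h := G.of_left' (IsPushout.of_hasPushout D₂₁.i₂'' g)
  ⟨_, _, _, h, D₂₁.isPushout_O.paste_vert h⟩

/-- The intersection of two subobjects is an overlap. It is admissible if the second subobject has a
pushout complement. -/
theorem exists_overlap {q p : LinearProduction C} {Z K : C} (y : q.I ⟶ Z) (z : p.O ⟶ Z) [Mono y]
    [Mono z] {k : p.K ⟶ K} {o : K ⟶ Z} (G : IsPushout p.o k z o) :
    ∃ m : Overlap q p, m.IsAdmissible ∧ IsPullback m.m₂ m.m₁ y z := by
  have sM := IsPullback.of_hasPullback y z
  have sP := IsPushout.of_hasPushout (pullback.fst y z) (pullback.snd y z)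
  obtain ⟨u, hy, hz⟩ := sP.exists_desc y z sM.w
  have : Mono u := by
    have h₁ : Mono (pushout.inl _ _ ≫ u) := by rw [hy]; infer_instance
    have h₂ : Mono (pushout.inr _ _ ≫ u) := by rw [hz]; infer_instance
    exact mono_of_isPushout_of_isPullback sP (by rwa [hy, hz])
  rw [← hz] at G
  -- Admissibility asks for a complement in the union of `y` and `z`, not in `Z`; the union embeds
  -- by `u`.
  obtain ⟨K', k', o', H⟩ := exists_isPushoutComplement_of_mono G
  exact ⟨{ M := pullback y z, m₂ := pullback.fst y z, m₁ := pullback.snd y z },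
    ⟨_, _, _, sP, _, _, _, H⟩, sM⟩

namespace AssocDiagram

theorem exists_of_m₃₂ (D₂₁ : CompositionDiagram m₂₁) (D₃₂ : CompositionDiagram m₃₂) {N B : C}
    {n₃ : p₃.I ⟶ N} {n₂₁ : D₂₁.O₂₁ ⟶ N} [Mono n₃] [Mono n₂₁] {g : D₂₁.K₂₁ ⟶ B} {o : B ⟶ N}
    (G : IsPushout (D₂₁.i₂'' ≫ D₂₁.o₂') g n₂₁ o)
    (H : IsPullback m₃₂.m₂ m₃₂.m₁ n₃ (D₂₁.nstar₂ ≫ n₂₁)) :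
    ∃ (X : C) (x₃₂ : D₃₂.I₂₁ ⟶ X) (x₁ : p₁.O ⟶ X), Mono x₃₂ ∧ Mono x₁ ∧
      Nonempty (AssocDiagram D₂₁ D₃₂ n₃ n₂₁ x₃₂ x₁) := by
  obtain ⟨K, s, a, Gs, Gk⟩ := D₂₁.exists_isPushout_complement_nstar₂ G
  have : Mono a := Adhesive.mono_of_isPushout_of_mono_left Gs
  have : Mono s := by
    have : Mono (s ≫ a) := by rw [← Gs.w]; infer_instance
    exact mono_of_mono s a
  obtain ⟨u, hu₂, hu₁⟩ := D₃₂.isPushout_N.exists_desc n₃ (D₂₁.nstar₂ ≫ n₂₁) H.w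
  have : Mono u := by
    have h₁ : Mono (D₃₂.n₂ ≫ u) := by rw [hu₂]; infer_instance
    have h₂ : Mono (D₃₂.n₁ ≫ u) := by rw [hu₁]; infer_instance
    exact mono_of_isPushout_of_isPullback D₃₂.isPushout_N (by rwa [hu₁, hu₂])
  obtain ⟨t, ht⟩ := exists_lift_of_isPushoutComplement Gk (D₃₂.o₁' ≫ u) (fun p x hp =>
    ⟨(Adhesive.isPullback_of_isPushout_of_mono_left D₃₂.isPushout_complement).lift x p
      (by rw [← cancel_mono u]; simp [hu₁, hp]), by simp⟩)
  have hk : D₂₁.k₂ ≫ s = D₃₂.k₁ ≫ t := by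
    rw [← cancel_mono a, ← Gk.w]
    simp [ht, ← hu₁, D₃₂.isPushout_complement.w_assoc]
  have Gt : IsPushout D₃₂.o₁' t u a := by
    rw [← hu₁, hk] at Gk
    exact Gk.of_top ht.symm D₃₂.isPushout_complement
  have : Mono t := by
    have : Mono (t ≫ a) := by rw [ht]; infer_instance
    exact mono_of_mono t a
  have Gb := IsPushout.of_hasPushout D₂₁.i₂' s
  have : Mono (pushout.inl D₂₁.i₂' s) := Adhesive.mono_of_isPushout_of_mono_right Gb
  have : Mono (pushout.inr D₂₁.i₂' s) := Adhesive.mono_of_isPushout_of_mono_left Gb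
  obtain ⟨x₃₂, hx, hx'⟩ := D₃₂.isPushout_I.exists_desc (D₂₁.n₂ ≫ pushout.inl D₂₁.i₂' s)
    (t ≫ pushout.inr D₂₁.i₂' s) (by
      rw [D₂₁.isFPC.isPullback.w_assoc, Gb.w, reassoc_of% hk])
  have hm : Mono x₃₂ := by
    have h₁ : Mono (D₃₂.nstar₁ ≫ x₃₂) := by rw [hx]; infer_instance
    have h₂ : Mono (D₃₂.i₁' ≫ x₃₂) := by rw [hx']; infer_instance
    refine mono_of_isPushout_of_isPullback D₃₂.isPushout_I ?_
    rw [hx, hx']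
    apply isPullback_of_comp_mono
    rw [← hk]
    exact D₂₁.isFPC.isPullback.flip.paste_horiz
      (Adhesive.isPullback_of_isPushout_of_mono_left Gb).flip |>.flip
  exact ⟨_, x₃₂, D₂₁.n₁ ≫ pushout.inl D₂₁.i₂' s, hm, inferInstance,
    ⟨⟨K, s, t, a, _, u, _, Gt, Gb, hu₂, hu₁, hx.symm, rfl, hk, Gs.w.symm, hx'.symm⟩⟩⟩

theorem exists_of_m₂₁ (D₂₁ : CompositionDiagram m₂₁) (D₃₂ : CompositionDiagram m₃₂) {X M : C}
    {x₃₂ : D₃₂.I₂₁ ⟶ X} {x₁ : p₁.O ⟶ X} [Mono x₃₂] [Mono x₁] {l₃₂ : M ⟶ D₃₂.I₂₁} {l₁ : M ⟶ p₁.O}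
    [Mono l₃₂] (G : IsPushout l₃₂ l₁ x₃₂ x₁)
    (H : IsPullback m₂₁.m₂ m₂₁.m₁ (D₃₂.nstar₁ ≫ x₃₂) x₁) :
    ∃ (N : C) (n₃ : p₃.I ⟶ N) (n₂₁ : D₂₁.O₂₁ ⟶ N), Mono n₃ ∧ Mono n₂₁ ∧
      Nonempty (AssocDiagram D₂₁ D₃₂ n₃ n₂₁ x₃₂ x₁) := by
  have sI := Adhesive.isPullback_of_isPushout_of_mono_left D₃₂.isPushout_I
  obtain ⟨v, hv₂, hv₁⟩ := D₂₁.isPushout_N.exists_desc (D₃₂.nstar₁ ≫ x₃₂) x₁ H.w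
  have : Mono v := by
    have h₁ : Mono (D₂₁.n₂ ≫ v) := by rw [hv₂]; infer_instance
    have h₂ : Mono (D₂₁.n₁ ≫ v) := by rw [hv₁]; infer_instance
    exact mono_of_isPushout_of_isPullback D₂₁.isPushout_N (by rwa [hv₁, hv₂])
  -- `D₃₂.Kbar₁ ⟶ D₃₂.I₂₁ ⟶ X` is not known to have a pushout complement, so `K` has to be taken as
  -- its FPC.
  obtain ⟨K, t, b, F⟩ := HasMonoFPCs.exists_isFPC D₃₂.i₁' x₃₂
  obtain ⟨_, _⟩ := HasMonoFPCs.mono_of_isFPC F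
  obtain ⟨s, hs⟩ := F.exists_lift (D₂₁.i₂' ≫ v) (fun p x hp => by
    refine exists_lift_of_isPushout D₃₂.isPushout_I x D₃₂.i₁' x (fun q y hq => ?_)
      (fun q y hq => ⟨y, hq.symm⟩)
    refine ⟨D₂₁.isFPC.isPullback.lift y (q ≫ p) ?_ ≫ D₃₂.k₁, ?_⟩
    · rw [← cancel_mono v]
      simp [hv₂, hp, reassoc_of% hq]
    · simp [← D₃₂.isPushout_I.w, hq])
  have : Mono s := by
    have : Mono (s ≫ b) := by rw [hs]; infer_instance
    exact mono_of_mono s b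
  have sb : IsPullback D₂₁.i₂' s v b := by
    refine isPullback_of_lift hs.symm fun x y h => D₂₁.isFPC.exists_lift x fun p q hq => ?_
    have hc : (q ≫ D₃₂.nstar₁) ≫ x₃₂ = (p ≫ y) ≫ b := by
      simp [← hv₂, ← h, reassoc_of% hq]
    exact ⟨sI.lift q (F.isPullback.lift _ _ hc) (by simp), by simp⟩
  have Gb : IsPushout D₂₁.i₂' s v b := by
    -- A subobject containing `D₂₁.N` and `K` contains `I₂` and `D₃₂.Kbar₁`, hence `D₃₂.I₂₁`; it
    -- also contains `O₁`, so by `G` it is all of `X`.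
    refine isPushout_of_isPullback_of_cover sb fun {D} d _ x y hx hy => ?_
    obtain ⟨z, hz⟩ := exists_lift_of_isPushout D₃₂.isPushout_I (𝟙 _) d x₃₂
      (fun p q hq => ⟨q ≫ D₂₁.n₂ ≫ x, by simp at hq; simp [hx, hq, hv₂]⟩)
      (fun p q hq => ⟨q ≫ t ≫ y, by simp at hq; simp [hy, hq, F.isPullback.w]⟩)
    exact exists_lift_of_isPushout G (𝟙 _) d (𝟙 _) (fun p q hq => ⟨q ≫ z, by simp [hz, ← hq]⟩)
      (fun p q hq => ⟨q ≫ D₂₁.n₁ ≫ x, by simp [hx, hv₁, ← hq]⟩)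
  have hk : D₂₁.k₂ ≫ s = D₃₂.k₁ ≫ t := by
    rw [← cancel_mono b]
    simp [hs, ← F.isPullback.w, ← D₂₁.isFPC.isPullback.w_assoc, hv₂, D₃₂.isPushout_I.w_assoc]
  have Ga := IsPushout.of_hasPushout D₃₂.o₁' t
  have : Mono (pushout.inl D₃₂.o₁' t) := Adhesive.mono_of_isPushout_of_mono_right Ga
  obtain ⟨n₂₁, hn, hn'⟩ := D₂₁.isPushout_O.exists_desc (D₃₂.n₁ ≫ pushout.inl D₃₂.o₁' t)
    (s ≫ pushout.inr D₃₂.o₁' t) (by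
      rw [D₃₂.isPushout_complement.w_assoc, Ga.w, reassoc_of% hk])
  let A : AssocDiagram D₂₁ D₃₂ (D₃₂.n₂ ≫ pushout.inl D₃₂.o₁' t) n₂₁ x₃₂ x₁ :=
    ⟨K, s, t, _, b, _, v, Ga, Gb, rfl, hn.symm, hv₂, hv₁, hk, hn'.symm, F.isPullback.w.symm⟩
  exact ⟨_, _, n₂₁, inferInstance, Adhesive.mono_of_isPushout_of_mono_right A.isPushout_s, ⟨A⟩⟩

/-- The middle object on one side is determined by the data on the other side. -/
theorem exists_hom_x {D₂₁ : CompositionDiagram m₂₁} {D₃₂ : CompositionDiagram m₃₂} {N X X' : C}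
    {n₃ : p₃.I ⟶ N} {n₂₁ : D₂₁.O₂₁ ⟶ N} {x₃₂ : D₃₂.I₂₁ ⟶ X} {x₁ : p₁.O ⟶ X}
    {x₃₂' : D₃₂.I₂₁ ⟶ X'} {x₁' : p₁.O ⟶ X'} (A : AssocDiagram D₂₁ D₃₂ n₃ n₂₁ x₃₂ x₁)
    (A' : AssocDiagram D₂₁ D₃₂ n₃ n₂₁ x₃₂' x₁') :
    ∃ f : X ⟶ X', x₃₂ ≫ f = x₃₂' ∧ x₁ ≫ f = x₁' := by
  obtain ⟨e, he⟩ := exists_lift_of_isPushoutComplement A'.isPushout_s A.a (fun p x hp =>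
    ⟨A.isPullback_s.lift x p hp.symm, by simp⟩)
  have hu : A.u = A'.u := by
    apply D₃₂.isPushout_N.hom_ext <;> simp [n₂_u, n₁_u]
  have hs : A.s ≫ e = A'.s := by
    rw [← cancel_mono A'.a]; simp [he, s_a]
  have ht : A.t ≫ e = A'.t := by
    rw [← cancel_mono A'.a]; simp [he, ← A.isPushout_a.w, ← A'.isPushout_a.w, hu]
  obtain ⟨f, hf, hf'⟩ := A.isPushout_b.exists_desc A'.v (e ≫ A'.b)
    (by rw [A'.isPushout_b.w, reassoc_of% hs])
  refine ⟨f, ?_, by rw [← A.n₁_v, Category.assoc, hf, A'.n₁_v]⟩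
  apply D₃₂.isPushout_I.hom_ext
  · rw [← reassoc_of% A.n₂_v, hf, A'.n₂_v]
  · rw [← reassoc_of% A.t_b, hf', reassoc_of% ht, A'.t_b]

/-- Here the two copies of `K` are compared by finality (`isFPC_t`) rather than as pushout
complements. -/
theorem exists_hom_n {D₂₁ : CompositionDiagram m₂₁} {D₃₂ : CompositionDiagram m₃₂} {N N' X : C}
    {n₃ : p₃.I ⟶ N} {n₂₁ : D₂₁.O₂₁ ⟶ N} {n₃' : p₃.I ⟶ N'} {n₂₁' : D₂₁.O₂₁ ⟶ N'}
    {x₃₂ : D₃₂.I₂₁ ⟶ X} {x₁ : p₁.O ⟶ X} (A : AssocDiagram D₂₁ D₃₂ n₃ n₂₁ x₃₂ x₁)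
    (A' : AssocDiagram D₂₁ D₃₂ n₃' n₂₁' x₃₂ x₁) :
    ∃ f : N ⟶ N', n₃ ≫ f = n₃' ∧ n₂₁ ≫ f = n₂₁' := by
  obtain ⟨e, he⟩ := A'.isFPC_t.exists_lift A.b (fun p x hp =>
    ⟨A.isPullback_t.lift x p hp.symm, by simp⟩)
  have hv : A.v = A'.v := by
    apply D₂₁.isPushout_N.hom_ext <;> simp [n₂_v, n₁_v]
  have ht : A.t ≫ e = A'.t := by
    rw [← cancel_mono A'.b]; simp [he, t_b]
  have hs : A.s ≫ e = A'.s := by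
    rw [← cancel_mono A'.b]; simp [he, ← A.isPushout_b.w, ← A'.isPushout_b.w, hv]
  obtain ⟨f, hf, hf'⟩ := A.isPushout_a.exists_desc A'.u (e ≫ A'.a)
    (by rw [A'.isPushout_a.w, reassoc_of% ht])
  refine ⟨f, by rw [← A.n₂_u, Category.assoc, hf, A'.n₂_u], ?_⟩
  apply D₂₁.isPushout_O.hom_ext
  · rw [← reassoc_of% A.n₁_u, hf, A'.n₁_u]
  · rw [← reassoc_of% A.s_a, hf', reassoc_of% hs, A'.s_a]

/-- Transport along isomorphisms of the two middle objects. -/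
def ofIso {D₂₁ : CompositionDiagram m₂₁} {D₃₂ : CompositionDiagram m₃₂} {N N' X X' : C}
    {n₃ : p₃.I ⟶ N} {n₂₁ : D₂₁.O₂₁ ⟶ N} {x₃₂ : D₃₂.I₂₁ ⟶ X} {x₁ : p₁.O ⟶ X}
    (A : AssocDiagram D₂₁ D₃₂ n₃ n₂₁ x₃₂ x₁) (e : N ≅ N') (f : X ≅ X')
    {n₃' : p₃.I ⟶ N'} {n₂₁' : D₂₁.O₂₁ ⟶ N'} {x₃₂' : D₃₂.I₂₁ ⟶ X'} {x₁' : p₁.O ⟶ X'}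
    (h₃ : n₃ ≫ e.hom = n₃') (h₂₁ : n₂₁ ≫ e.hom = n₂₁') (h₃₂ : x₃₂ ≫ f.hom = x₃₂')
    (h₁ : x₁ ≫ f.hom = x₁') : AssocDiagram D₂₁ D₃₂ n₃' n₂₁' x₃₂' x₁' where
  K := A.K
  s := A.s
  t := A.t
  a := A.a ≫ e.hom
  b := A.b ≫ f.hom
  u := A.u ≫ e.hom
  v := A.v ≫ f.hom
  isPushout_a := A.isPushout_a.of_iso (Iso.refl _) (Iso.refl _) (Iso.refl _) e (by simp) (by simp)
    (by simp) (by simp)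
  isPushout_b := A.isPushout_b.of_iso (Iso.refl _) (Iso.refl _) (Iso.refl _) f (by simp) (by simp)
    (by simp) (by simp)
  n₂_u := by rw [← h₃, reassoc_of% A.n₂_u]
  n₁_u := by rw [← h₂₁, reassoc_of% A.n₁_u]
  n₂_v := by rw [← h₃₂, reassoc_of% A.n₂_v]
  n₁_v := by rw [← h₁, reassoc_of% A.n₁_v]
  k₂_s := A.k₂_s
  s_a := by rw [← h₂₁, reassoc_of% A.s_a]
  t_b := by rw [← h₃₂, reassoc_of% A.t_b]

end AssocDiagram

end SqPO

/-! ### Isomorphism of the two composites. -/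

namespace SqPO

variable {C : Type u} [Category.{v} C] {p₁ p₂ p₃ : LinearProduction C}
  {m₂₁ : Overlap p₂ p₁} {m₃₂ : Overlap p₃ p₂}

theorem LinearProduction.IsIsomorphic.trans {p q r : LinearProduction C} (h : p.IsIsomorphic q)
    (h' : q.IsIsomorphic r) : p.IsIsomorphic r := by
  obtain ⟨eO, eK, eI, ho, hi⟩ := h
  obtain ⟨fO, fK, fI, ho', hi'⟩ := h'
  exact ⟨eO ≪≫ fO, eK ≪≫ fK, eI ≪≫ fI, by simp [reassoc_of% ho, ho'],
    by simp [reassoc_of% hi, hi']⟩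

variable [HasPullbacks C] [Adhesive C] [HasMonoFPCs C]

theorem exists_isPushout_of_mono {X Y Z : C} (f : X ⟶ Y) (g : X ⟶ Z) [Mono f] :
    ∃ (P : C) (h : Y ⟶ P) (i : Z ⟶ P), IsPushout f g h i :=
  ⟨_, _, _, IsPushout.of_hasPushout f g⟩

namespace AssocDiagram

/-- `B` is the intersection of the two contexts of the right-hand composition. -/
theorem isPullback_r {D₂₁ : CompositionDiagram m₂₁} {D₃₂ : CompositionDiagram m₃₂} {N X : C}
    {n₃ : p₃.I ⟶ N} {n₂₁ : D₂₁.O₂₁ ⟶ N} {x₃₂ : D₃₂.I₂₁ ⟶ X} {x₁ : p₁.O ⟶ X}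
    (A : AssocDiagram D₂₁ D₃₂ n₃ n₂₁ x₃₂ x₁) [Mono n₂₁] {B L : C} {g : D₂₁.K₂₁ ⟶ B} {r : B ⟶ A.K}
    {j : D₂₁.Kbar₁ ⟶ L} {h : B ⟶ L} (H : IsPushout D₂₁.o₁'' g j h) {o : L ⟶ X} [Mono o]
    (hj : j ≫ o = D₂₁.o₁' ≫ A.v) (ho : h ≫ o = r ≫ A.b) :
    IsPullback r h A.b o := by
  have : Mono h := Adhesive.mono_of_isPushout_of_mono_left H
  refine (isPullback_of_lift (f := h) (i := A.b) ho fun {T} x y hxy => ?_).flip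
  refine exists_lift_of_isPushout H x h x (fun p q hq => ?_) (fun p q hq => ⟨q, hq.symm⟩)
  have h₁ : (q ≫ D₂₁.o₁') ≫ A.v = (p ≫ y) ≫ A.b := by
    simp [← hxy, reassoc_of% hq, hj]
  refine ⟨D₂₁.isPullback_K.lift (A.isPullback_b.lift _ _ h₁) q (by simp) ≫ g, ?_⟩
  simp [← H.w, hq]

variable {D₂₁ : CompositionDiagram m₂₁} {D₃₂ : CompositionDiagram m₃₂} {N X : C}
  {n₃ : p₃.I ⟶ N} {n₂₁ : D₂₁.O₂₁ ⟶ N} {x₃₂ : D₃₂.I₂₁ ⟶ X} {x₁ : p₁.O ⟶ X}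
  {Q : C} {κ : p₃.K ⟶ Q} {ι : Q ⟶ N}

/-- The inclusion of the context of `p₃` in the smaller composition into the one in the larger. -/
theorem exists_isPullback_w [Mono x₃₂] [Mono ι] (A : AssocDiagram D₂₁ D₃₂ n₃ n₂₁ x₃₂ x₁)
    (HF : IsFPC p₃.i n₃ κ ι) :
    ∃ w : D₃₂.Kbar₂ ⟶ Q, Mono w ∧ IsPullback D₃₂.i₂' w A.u ι ∧ D₃₂.k₂ ≫ w = κ := by
  obtain ⟨w, hw⟩ := HF.exists_lift (D₃₂.i₂' ≫ A.u) (fun p x hp =>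
    ⟨D₃₂.isFPC.isPullback.lift x p (by rw [← cancel_mono A.u]; simp [A.n₂_u, hp]), by simp⟩)
  have : Mono w := by
    have : Mono (w ≫ ι) := by rw [hw]; infer_instance
    exact mono_of_mono w ι
  refine ⟨w, this, isPullback_of_lift hw.symm fun {T} x y hxy => ?_, ?_⟩
  · refine D₃₂.isFPC.exists_lift x fun p q hq => ?_
    exact ⟨HF.isPullback.lift q (p ≫ y)
      (by rw [← A.n₂_u]; simp [← hxy, reassoc_of% hq]), by simp⟩
  · rw [← cancel_mono ι]
    simp [hw, ← HF.isPullback.w, ← D₃₂.isFPC.isPullback.w_assoc, A.n₂_u]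

/-- The context of the composite of `p₃` and `p₂` in `X` is the intersection of `Q` and `K`.
Finality is used twice: `isFPC_t` puts an element of `X` into `K`, then `HF` puts its image in `N`
into `Q`. -/
theorem isFPC_composite [Mono x₃₂] [Mono ι] (A : AssocDiagram D₂₁ D₃₂ n₃ n₂₁ x₃₂ x₁)
    (HF : IsFPC p₃.i n₃ κ ι) {w : D₃₂.Kbar₂ ⟶ Q}
    (hw : IsPullback D₃₂.i₂' w A.u ι) {L : C} {l₁ : L ⟶ Q} {l₂ : L ⟶ A.K}
    (hL : IsPullback l₁ l₂ ι A.a) {k : D₃₂.K₂₁ ⟶ L}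
    (hk₂ : k ≫ l₂ = D₃₂.o₁'' ≫ A.t) : IsFPC (D₃₂.o₁'' ≫ D₃₂.i₁') x₃₂ k (l₂ ≫ A.b) := by
  have : Mono l₂ := (MorphismProperty.monomorphisms C).of_isPullback hL
    (MorphismProperty.monomorphisms.infer_property ι)
  have : Mono (l₂ ≫ A.b) := mono_comp _ _
  refine isFPC_of_exists_lift (isPullback_of_lift ?_ fun {T} x y hxy => ?_) fun {T} z hz => ?_
  · simp [reassoc_of% hk₂, A.t_b]
  · have h₁ : x ≫ x₃₂ = (y ≫ l₂) ≫ A.b := by simpa using hxy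
    have h₂ : (A.isPullback_t.lift _ _ h₁ ≫ D₃₂.o₁') ≫ A.u = (y ≫ l₁) ≫ ι := by
      simp [A.isPushout_a.w, hL.w]
    exact ⟨D₃₂.isPullback_K.lift (hw.lift _ _ h₂) (A.isPullback_t.lift _ _ h₁) (by simp), by simp⟩
  · obtain ⟨z, rfl⟩ := A.isFPC_t.exists_lift z fun p x hp => by
      obtain ⟨l, hl⟩ := hz p x hp
      exact ⟨l ≫ D₃₂.o₁'', by simp [hl]⟩
    obtain ⟨y, hy⟩ := HF.exists_lift (z ≫ A.a) fun p x hp => by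
      have h₁ : (x ≫ D₃₂.n₂) ≫ A.u = (p ≫ z) ≫ A.a := by simp [A.n₂_u, hp]
      obtain ⟨l, hl⟩ := hz p (A.isPullback_a.lift _ _ h₁ ≫ D₃₂.i₁') (by
        simp [← A.t_b])
      have hl' : l ≫ D₃₂.o₁'' = A.isPullback_a.lift _ _ h₁ := by
        rw [← cancel_mono D₃₂.i₁']; simpa using hl
      have h₂ : x ≫ D₃₂.n₂ = (l ≫ D₃₂.i₂'') ≫ D₃₂.i₂' := by
        simp [D₃₂.isPullback_K.w, reassoc_of% hl']
      exact ⟨D₃₂.isFPC.isPullback.lift x _ h₂, by simp⟩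
    exact ⟨hL.lift y z hy, by simp⟩

theorem isIsomorphic_composite {m₃₂₁ : Overlap p₃ D₂₁.composite} (E : CompositionDiagram m₃₂₁)
    {m₃₂₁' : Overlap D₃₂.composite p₁} (F : CompositionDiagram m₃₂₁')
    (A : AssocDiagram D₂₁ D₃₂ E.n₂ E.n₁ F.n₂ F.n₁) :
    E.composite.IsIsomorphic F.composite := by
  have : @Mono C _ D₃₂.I₂₁ F.N F.n₂ := inferInstanceAs (Mono F.n₂)
  have : @Mono C _ D₂₁.O₂₁ E.N E.n₁ := inferInstanceAs (Mono E.n₁)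
  have G : IsPushout (D₂₁.i₂'' ≫ D₂₁.o₂') E.k₁ E.n₁ E.o₁' := E.isPushout_complement
  obtain ⟨r, hr, Gr⟩ := A.exists_isPushout_r G
  obtain ⟨L, j, h, H⟩ := exists_isPushout_of_mono D₂₁.o₁'' (E.k₁ : D₂₁.K₂₁ ⟶ E.Kbar₁)
  obtain ⟨o, ho, Go⟩ := A.exists_isPushout_complement_x Gr H
  have : Mono o := Adhesive.mono_of_isPushout_of_mono_left Go
  have Pr := A.isPullback_r H Go.w.symm ho
  obtain ⟨w, _, hw, hkw⟩ := A.exists_isPullback_w E.isFPC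
  have hL := IsPullback.of_hasPullback E.i₂' A.a
  obtain ⟨k, hk₁, hk₂⟩ := hL.exists_lift (D₃₂.i₂'' ≫ w) (D₃₂.o₁'' ≫ A.t) (by
    simp [← hw.w, ← A.isPushout_a.w, D₃₂.isPullback_K.w_assoc])
  have hF := A.isFPC_composite E.isFPC hw hL hk₂
  have Go' := D₂₁.isPushout_complement.paste_vert Go
  rw [A.n₁_v] at Go'
  have hI : IsPushout (D₂₁.o₁'' ≫ D₂₁.i₁') E.k₁ E.nstar₁ E.i₁' := E.isPushout_I
  obtain ⟨i, hi, hi'⟩ := H.exists_desc (D₂₁.i₁' ≫ E.nstar₁) E.i₁' 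
    ((Category.assoc _ _ _).symm.trans hI.w)
  have hI' := D₂₁.isPushout_I.paste_vert ((hi' ▸ hI).of_left hi.symm H)
  have hO := E.isPushout_O
  rw [← hkw] at hO
  obtain ⟨c, hc, hc'⟩ := D₃₂.isPushout_O.exists_desc E.nstar₂ (w ≫ E.o₂') (by simpa using hO.w)
  have hO' := (hc.symm ▸ hO).of_top hc' D₃₂.isPushout_O
  have hk : IsPushout D₃₂.i₂'' k w (pullback.fst E.i₂' A.a) :=
    isPushout_of_isPullback A.isPushout_a hw.flip hL D₃₂.isPullback_K hk₁.symm hk₂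
  have hO'' := hk.paste_horiz hO'
  have hK := E.isPullback_K
  rw [← hr] at hK
  obtain ⟨l, hl₁, hl₂⟩ := hL.exists_lift E.i₂'' (E.o₁'' ≫ r) (by simpa using hK.w)
  have hK' := (IsPullback.of_right (hl₁.symm ▸ hK) hl₂ hL).paste_vert Pr
  -- The outer objects are those of `E`, only the contexts are new. The apex stays `E.K₂₁` because
  -- `E.Kbar₁` is the intersection of `K` and `L` in `X` (`Pr`).
  let F' : CompositionDiagram m₃₂₁' :=
    { N := F.N
      n₂ := F.n₂
      n₁ := F.n₁
      isPushout_N := F.isPushout_N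
      Kbar₁ := L
      k₁ := D₂₁.k₁ ≫ j
      o₁' := o
      isPushout_complement := Go'
      I₂₁ := E.I₂₁
      nstar₁ := D₂₁.nstar₁ ≫ E.nstar₁
      i₁' := i
      isPushout_I := hI'
      Kbar₂ := pullback E.i₂' A.a
      k₂ := k
      i₂' := pullback.snd E.i₂' A.a ≫ A.b
      isFPC := hF
      O₂₁ := E.O₂₁
      nstar₂ := c
      o₂' := pullback.fst E.i₂' A.a ≫ E.o₂'
      isPushout_O := hO''
      K₂₁ := E.K₂₁
      i₂'' := l
      o₁'' := E.o₁'' ≫ h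
      isPullback_K := hK' }
  have hEF : E.composite.IsIsomorphic F'.composite := by
    refine ⟨Iso.refl _, Iso.refl _, Iso.refl _, ?_, ?_⟩
    · simp [CompositionDiagram.composite, F', reassoc_of% hl₁]
    · simp [CompositionDiagram.composite, F', hi']
  exact hEF.trans (F'.isIsomorphic_composite F)

end AssocDiagram

end SqPO

/-! ### The one-to-one correspondence of matches. -/

namespace SqPO

variable {C : Type u} [Category.{v} C] {p₁ p₂ p₃ : LinearProduction C}
  [HasPullbacks C] [Adhesive C] [HasMonoFPCs C]

namespace AdmissibleMatch

/-- The chosen overlap representing an admissible match. -/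
noncomputable def overlap (m : AdmissibleMatch p₂ p₁) : Overlap p₂ p₁ := (Quotient.out m).1

/-- The chosen composition diagram of an admissible match. -/
noncomputable def diagram (m : AdmissibleMatch p₂ p₁) : CompositionDiagram m.overlap :=
  Classical.choice (CompositionDiagram.nonempty (Quotient.out m).2)

theorem exists_isPullback {m : Overlap p₂ p₁} (hm : m.IsAdmissible) {Z : C} {y : p₂.I ⟶ Z}
    {z : p₁.O ⟶ Z} (H : IsPullback m.m₂ m.m₁ y z) :
    ∃ m' : AdmissibleMatch p₂ p₁, IsPullback m'.overlap.m₂ m'.overlap.m₁ y z := by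
  obtain ⟨e, h₂, h₁⟩ := Quotient.mk_out (s := overlapSetoid p₂ p₁) ⟨m, hm⟩
  exact ⟨Quotient.mk _ ⟨m, hm⟩, H.of_iso e.symm (Iso.refl _) (Iso.refl _) (Iso.refl _)
    (by simp [← h₂, overlap]) (by simp [← h₁, overlap]) (by simp) (by simp)⟩

/-- Morphisms of cospans in both directions suffice, inverse or not: the legs of the overlaps are
monomorphisms, so the induced maps between the apexes are inverse. -/
theorem eq_of_isPullback {m m' : AdmissibleMatch p₂ p₁} {Z Z' : C} {y : p₂.I ⟶ Z} {z : p₁.O ⟶ Z}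
    {y' : p₂.I ⟶ Z'} {z' : p₁.O ⟶ Z'} (H : IsPullback m.overlap.m₂ m.overlap.m₁ y z)
    (H' : IsPullback m'.overlap.m₂ m'.overlap.m₁ y' z')
    (h : ∃ f : Z ⟶ Z', y ≫ f = y' ∧ z ≫ f = z') (h' : ∃ f : Z' ⟶ Z, y' ≫ f = y ∧ z' ≫ f = z) :
    m = m' := by
  obtain ⟨f, hy, hz⟩ := h
  obtain ⟨f', hy', hz'⟩ := h'
  refine Quotient.out_equiv_out.1 ?_
  obtain ⟨k, hk₂, hk₁⟩ := H'.exists_lift m.overlap.m₂ m.overlap.m₁ (by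
    rw [← hy, ← hz, H.w_assoc])
  obtain ⟨l, hl₂, hl₁⟩ := H.exists_lift m'.overlap.m₂ m'.overlap.m₁ (by
    rw [← hy', ← hz', H'.w_assoc])
  let e : m.overlap.M ≅ m'.overlap.M :=
    ⟨k, l, by rw [← cancel_mono m.overlap.m₂]; simp [hl₂, hk₂],
      by rw [← cancel_mono m'.overlap.m₂]; simp [hl₂, hk₂]⟩
  exact ⟨e, hk₂, hk₁⟩

end AdmissibleMatch

/-- Two nested compositions correspond to each other if they have a common refinement. -/
def IsAssocPair (x : Σ m₂₁ : AdmissibleMatch p₂ p₁, AdmissibleMatch p₃ (comp p₂ m₂₁))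
    (y : Σ m₃₂ : AdmissibleMatch p₃ p₂, AdmissibleMatch (comp p₃ m₃₂) p₁) : Prop :=
  Nonempty (AssocDiagram x.1.diagram y.1.diagram x.2.diagram.n₂ x.2.diagram.n₁ y.2.diagram.n₂
    y.2.diagram.n₁)

namespace IsAssocPair

theorem isIsomorphic {x : Σ m₂₁ : AdmissibleMatch p₂ p₁, AdmissibleMatch p₃ (comp p₂ m₂₁)}
    {y : Σ m₃₂ : AdmissibleMatch p₃ p₂, AdmissibleMatch (comp p₃ m₃₂) p₁} (h : IsAssocPair x y) :
    (comp p₃ x.2).IsIsomorphic (comp (comp p₃ y.1) y.2) :=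
  h.some.isIsomorphic_composite x.2.diagram y.2.diagram

theorem exists_right (x : Σ m₂₁ : AdmissibleMatch p₂ p₁, AdmissibleMatch p₃ (comp p₂ m₂₁)) :
    ∃ y : Σ m₃₂ : AdmissibleMatch p₃ p₂, AdmissibleMatch (comp p₃ m₃₂) p₁, IsAssocPair x y := by
  obtain ⟨m₂₁, m⟩ := x
  have : @Mono C _ m₂₁.diagram.O₂₁ m.diagram.N m.diagram.n₁ :=
    inferInstanceAs (Mono m.diagram.n₁)
  have G : IsPushout (m₂₁.diagram.i₂'' ≫ m₂₁.diagram.o₂') m.diagram.k₁ m.diagram.n₁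
    m.diagram.o₁' := m.diagram.isPushout_complement
  obtain ⟨K, s, a, -, Gk⟩ := m₂₁.diagram.exists_isPushout_complement_nstar₂ G
  have : @Mono C _ _ _ (m₂₁.diagram.nstar₂ ≫ m.diagram.n₁) := mono_comp _ _
  obtain ⟨m₀, hm₀, H₀⟩ := exists_overlap m.diagram.n₂ (m₂₁.diagram.nstar₂ ≫ m.diagram.n₁) Gk
  obtain ⟨m₃₂, H⟩ := AdmissibleMatch.exists_isPullback hm₀ H₀
  obtain ⟨X, x₃₂, x₁, hx, _, ⟨A⟩⟩ := AssocDiagram.exists_of_m₃₂ m₂₁.diagram m₃₂.diagram G H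
  obtain ⟨r, -, Gr⟩ := A.exists_isPushout_r G
  obtain ⟨L, j, h, HL⟩ := exists_isPushout_of_mono m₂₁.diagram.o₁''
    (m.diagram.k₁ : m₂₁.diagram.K₂₁ ⟶ m.diagram.Kbar₁)
  obtain ⟨o, -, Go⟩ := A.exists_isPushout_complement_x Gr HL
  have Go' := m₂₁.diagram.isPushout_complement.paste_vert Go
  rw [A.n₁_v] at Go'
  have : @Mono C _ (comp p₃ m₃₂).I X x₃₂ := hx
  obtain ⟨m₁, hm₁, H₁⟩ := exists_overlap (q := comp p₃ m₃₂) x₃₂ x₁ Go'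
  obtain ⟨m', H'⟩ := AdmissibleMatch.exists_isPullback hm₁ H₁
  -- The overlap was built as an intersection in `X`; that `X` is also its pushout identifies `X`
  -- with the middle object of the chosen diagram.
  have P := A.isPushout_x m.diagram.isPushout_N H'
  exact ⟨⟨m₃₂, m'⟩, ⟨A.ofIso (Iso.refl _) (P.isoIsPushout _ _ m'.diagram.isPushout_N)
    (Category.comp_id _) (Category.comp_id _) (P.inl_isoIsPushout_hom _ _ m'.diagram.isPushout_N)
    (P.inr_isoIsPushout_hom _ _ m'.diagram.isPushout_N)⟩⟩

theorem exists_left (y : Σ m₃₂ : AdmissibleMatch p₃ p₂, AdmissibleMatch (comp p₃ m₃₂) p₁) :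
    ∃ x : Σ m₂₁ : AdmissibleMatch p₂ p₁, AdmissibleMatch p₃ (comp p₂ m₂₁), IsAssocPair x y := by
  obtain ⟨m₃₂, m⟩ := y
  have : @Mono C _ m₃₂.diagram.I₂₁ m.diagram.N m.diagram.n₂ :=
    inferInstanceAs (Mono m.diagram.n₂)
  have G := m.diagram.isPushout_complement
  have : @Mono C _ _ _ (m₃₂.diagram.nstar₁ ≫ m.diagram.n₂) := mono_comp _ _
  obtain ⟨m₀, hm₀, H₀⟩ := exists_overlap (m₃₂.diagram.nstar₁ ≫ m.diagram.n₂) m.diagram.n₁ G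
  obtain ⟨m₂₁, H⟩ := AdmissibleMatch.exists_isPullback hm₀ H₀
  have hM : @Mono C _ m.overlap.M m₃₂.diagram.I₂₁ m.overlap.m₂ :=
    inferInstanceAs (Mono m.overlap.m₂)
  obtain ⟨N, n₃, n₂₁, _, hn, ⟨A⟩⟩ := AssocDiagram.exists_of_m₂₁ m₂₁.diagram m₃₂.diagram
    m.diagram.isPushout_N H
  obtain ⟨B, g, o, Go⟩ := A.exists_isPushout_complement_n G
  have : @Mono C _ (comp p₂ m₂₁).O N n₂₁ := hn
  obtain ⟨m₁, hm₁, H₁⟩ := exists_overlap (p := comp p₂ m₂₁) n₃ n₂₁ Go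
  obtain ⟨m', H'⟩ := AdmissibleMatch.exists_isPullback hm₁ H₁
  have P := A.isPushout_n H' m.diagram.isPushout_N
  exact ⟨⟨m₂₁, m'⟩, ⟨A.ofIso (P.isoIsPushout _ _ m'.diagram.isPushout_N) (Iso.refl _)
    (P.inl_isoIsPushout_hom _ _ m'.diagram.isPushout_N)
    (P.inr_isoIsPushout_hom _ _ m'.diagram.isPushout_N)
    (Category.comp_id _) (Category.comp_id _)⟩⟩

/-- Both first matches are the same intersection in `N`; once they agree, `exists_hom_x` compares
the two middle objects. -/
theorem right_unique {x : Σ m₂₁ : AdmissibleMatch p₂ p₁, AdmissibleMatch p₃ (comp p₂ m₂₁)}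
    {y y' : Σ m₃₂ : AdmissibleMatch p₃ p₂, AdmissibleMatch (comp p₃ m₃₂) p₁}
    (h : IsAssocPair x y) (h' : IsAssocPair x y') : y = y' := by
  obtain ⟨m₃₂, m⟩ := y
  obtain ⟨m₃₂', m'⟩ := y'
  obtain ⟨A⟩ := h
  obtain ⟨A'⟩ := h'
  have : @Mono C _ m₃₂.diagram.I₂₁ m.diagram.N m.diagram.n₂ :=
    inferInstanceAs (Mono m.diagram.n₂)
  have : @Mono C _ m₃₂'.diagram.I₂₁ m'.diagram.N m'.diagram.n₂ :=
    inferInstanceAs (Mono m'.diagram.n₂)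
  obtain rfl : m₃₂ = m₃₂' := AdmissibleMatch.eq_of_isPullback A.isPullback_m₃₂ A'.isPullback_m₃₂
    ⟨𝟙 _, by simp, by simp⟩ ⟨𝟙 _, by simp, by simp⟩
  obtain rfl : m = m' := AdmissibleMatch.eq_of_isPullback
    (Adhesive.isPullback_of_isPushout_of_mono_left m.diagram.isPushout_N)
    (Adhesive.isPullback_of_isPushout_of_mono_left m'.diagram.isPushout_N)
    (A.exists_hom_x A') (A'.exists_hom_x A)
  rfl

theorem left_unique {x x' : Σ m₂₁ : AdmissibleMatch p₂ p₁, AdmissibleMatch p₃ (comp p₂ m₂₁)}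
    {y : Σ m₃₂ : AdmissibleMatch p₃ p₂, AdmissibleMatch (comp p₃ m₃₂) p₁}
    (h : IsAssocPair x y) (h' : IsAssocPair x' y) : x = x' := by
  obtain ⟨m₂₁, m⟩ := x
  obtain ⟨m₂₁', m'⟩ := x'
  obtain ⟨A⟩ := h
  obtain ⟨A'⟩ := h'
  have : @Mono C _ m₂₁.diagram.O₂₁ m.diagram.N m.diagram.n₁ :=
    inferInstanceAs (Mono m.diagram.n₁)
  have : @Mono C _ m₂₁'.diagram.O₂₁ m'.diagram.N m'.diagram.n₁ :=
    inferInstanceAs (Mono m'.diagram.n₁)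
  obtain rfl : m₂₁ = m₂₁' := AdmissibleMatch.eq_of_isPullback A.isPullback_m₂₁ A'.isPullback_m₂₁
    ⟨𝟙 _, by simp, by simp⟩ ⟨𝟙 _, by simp, by simp⟩
  obtain rfl : m = m' := AdmissibleMatch.eq_of_isPullback
    (Adhesive.isPullback_of_isPushout_of_mono_left m.diagram.isPushout_N)
    (Adhesive.isPullback_of_isPushout_of_mono_left m'.diagram.isPushout_N)
    (A.exists_hom_n A') (A'.exists_hom_n A)
  rfl

end IsAssocPair

end SqPO

theorem mainTheorem2 {C : Type u} [Category.{v} C] [HasPullbacks C] [Adhesive C]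
    [SqPO.HasMonoFPCs C] (p₁ p₂ p₃ : SqPO.LinearProduction C) :
    ∃ e : (Σ m₂₁ : SqPO.AdmissibleMatch p₂ p₁, SqPO.AdmissibleMatch p₃ (SqPO.comp p₂ m₂₁)) ≃
        (Σ m₃₂ : SqPO.AdmissibleMatch p₃ p₂, SqPO.AdmissibleMatch (SqPO.comp p₃ m₃₂) p₁),
      ∀ x, (SqPO.comp p₃ x.2).IsIsomorphic (SqPO.comp (SqPO.comp p₃ (e x).1) (e x).2) := by
  choose f hf using SqPO.IsAssocPair.exists_right (p₁ := p₁) (p₂ := p₂) (p₃ := p₃)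
  choose g hg using SqPO.IsAssocPair.exists_left (p₁ := p₁) (p₂ := p₂) (p₃ := p₃)
  exact ⟨⟨f, g, fun x => (hg (f x)).left_unique (hf x), fun y => (hf (g y)).right_unique (hg y)⟩,
    fun x => (hf x).isIsomorphic⟩
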